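/- Let $\mathbb{F}$ be a field complete with respect to a non-trivial non-archimedean norm $|\cdot|$, and let $t\in\mathbb{F}$ with $0<|t|<1$. Let $\lambda$ be a partition (possibly empty), and let $\lambda^{(\infty)}$ be the infinite diagram obtained by placing a row of infinitely many boxes on top of the Young diagram of $\lambda$. Let $\mathrm{SYT}_\infty(\lambda)$ be the set of bijections $\tau:\lambda^{(\infty)}\to\{1,2,3,\dots\}$ that increase strictly from left to right along rows and from top to bottom down columns. For $\tau\in \mathrm{SYT}_\infty(\lambda)$ let $c_\tau(i)$ be the content (column minus row) of the box labelled $i$. If $i,i+1$ are neither in the same row nor in the same column of $\tau$, let $s_i(\tau)\in \mathrm{SYT}_\infty(\lambda)$ be obtained by interchanging the labels $i$ and $i+1$; write $s_i(\tau)>\tau$ if $i+1$ lies strictly to the right of and strictly above $i$ in $\tau$, and $s_i(\tau)<\tau$ otherwise. Let $\tau_\lambda$ be the column-standard tableau, whose columns are filled with consecutive labels from top to bottom, one column after the other from left to right. Let $\mathrm{inv}(\tau)$ be the least $r$ such that $\tau=s_{i_r}\cdots s_{i_1}(\tau_\lambda)$ for some $i_1,\dots,i_r\geq 1$, all intermediate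 tableaux being defined. Let $\hat S_\lambda$ be the Banach space of formal sums $\sum_{\tau\in \mathrm{SYT}_\infty(\lambda)}\alpha_\tau e_\tau$, $\alpha_\tau\in\mathbb{F}$, such that for every $c>0$ only finitely many $\tau$ satisfy $|\alpha_\tau|\geq c$, with norm $\sup_\tau|\alpha_\tau|$. For $i\geq 1$ let $T_i$ be the bounded operator on $\hat S_\lambda$ given by $T_i\big(\sum_\tau\alpha_\tau e_\tau\big)=\sum_\tau\alpha_\tau T_i(e_\tau)$, where - $T_i(e_\tau)=e_\tau$ if $i,i+1$ are in the same row of $\tau$, and $T_i(e_\tau)=-t\,e_\tau$ if they are in the same column; - if $s_i(\tau)>\tau$ and $d=c_\tau(i+1)-c_\tau(i)$, then $T_i(e_\tau)=e_{s_i(\tau)}+\frac{1-t}{1-t^{d}}e_\tau$; - if $s_i(\tau)<\tau$ and $d=c_\tau(i)-c_\tau(i+1)$, then $T_i(e_\tau)=t\,\frac{(1-t^{d-1})(1-t^{d+1})}{(1-t^{d})^2}\,e_{s_i(\tau)}-t^{d}\,\frac{1-t}{1-t^{d}}\,e_\tau$. Theorem. There is a unique non-degenerate continuous symmetric bilinear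 form $(-,-)_\lambda:\hat S_\lambda\times\hat S_\lambda\to\mathbb{F}$ such that $(e_{\tau_\lambda},e_{\tau_\lambda})_\lambda=1$ and $(T_i v,w)_\lambda=(v,T_i w)_\lambda$ for all $i\geq 1$ and $v,w\in\hat S_\lambda$. Moreover, there is a unique function $a:\mathrm{SYT}_\infty(\lambda)\to\mathbb{F}$ such that $a(\tau_\lambda)=1$ and, whenever $s_i(\tau)>\tau$, $$a(s_i(\tau))=\frac{(t^{d}-t)(t^{d+1}-1)}{(t^{d}-1)^2}\,a(\tau),\qquad d=c_\tau(i+1)-c_\tau(i);$$ it satisfies $|a(\tau)|=|t|^{\mathrm{inv}(\tau)}$ for all $\tau$, and $$\Big(\sum_\tau\alpha_\tau e_\tau,\ \sum_\tau\beta_\tau e_\tau\Big)_\lambda=\sum_\tau\alpha_\tau\beta_\tau\,a(\tau)$$ for all elements of $\hat S_\lambda$, the series on the right being convergent. -/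

import Mathlib

open Filter Topology
open scoped ZeroAtInfty

noncomputable section

namespace InfHecke

/-! ### Infinite diagrams and standard tableaux

Partitions are Young diagrams; the box in row `r` and column `c`, both counted from `0` and with
row `0` on top, is `(r, c)`. The labels `1, 2, 3, …` of a tableau are counted from `0` as well:
the number `k : ℕ` stands for the label `k + 1`. Consequently the index `i : ℕ` of a generator
stands for `i + 1`: it concerns the labels `i + 1` and `i + 2`. -/

/-- The infinite diagram obtained by putting an infinite row on top of the diagram `lam`:
the union of the diagrams of `(n - |lam|, lam)` for `n` large. -/
def cells (lam : YoungDiagram) : Set (ℕ × ℕ) :=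
  {b | b.1 = 0 ∨ ∃ r, b.1 = r + 1 ∧ (r, b.2) ∈ lam}

/-- Standard tableaux on the infinite diagram: bijective labelings of the boxes that increase
strictly along rows (left to right) and down columns. -/
@[ext]
structure Tableau (lam : YoungDiagram) where
  entry : cells lam ≃ ℕ
  row_lt : ∀ b b' : cells lam, b.1.1 = b'.1.1 → b.1.2 < b'.1.2 → entry b < entry b'
  col_lt : ∀ b b' : cells lam, b.1.2 = b'.1.2 → b.1.1 < b'.1.1 → entry b < entry b'

variable {lam : YoungDiagram}

/-- The set of tableaux is an index set; it carries the discrete topology. -/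
instance : TopologicalSpace (Tableau lam) := ⊥

instance : DiscreteTopology (Tableau lam) := ⟨rfl⟩

namespace Tableau

/-- The row of the box with label `k`. -/
def row (τ : Tableau lam) (k : ℕ) : ℕ := (τ.entry.symm k).1.1

/-- The column of the box with label `k`. -/
def col (τ : Tableau lam) (k : ℕ) : ℕ := (τ.entry.symm k).1.2

/-- The content (column minus row) of the box with label `k`. -/
def content (τ : Tableau lam) (k : ℕ) : ℤ := (τ.col k : ℤ) - (τ.row k : ℤ)

/-- The labels `i` and `i + 1` lie neither in the same row nor in the same column; equivalently,
interchanging them gives again a standard tableau. -/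
def Swappable (τ : Tableau lam) (i : ℕ) : Prop :=
  τ.row i ≠ τ.row (i + 1) ∧ τ.col i ≠ τ.col (i + 1)

theorem swap_lt {i m n : ℕ} (h : m < n) (h' : ¬ (m = i ∧ n = i + 1)) :
    Equiv.swap i (i + 1) m < Equiv.swap i (i + 1) n := by
  simp only [Equiv.swap_apply_def]
  split_ifs <;> omega

/-- The tableau `s_i(τ)`, obtained from `τ` by interchanging the labels `i` and `i + 1`. -/
def swap (τ : Tableau lam) (i : ℕ) (h : τ.Swappable i) : Tableau lam where
  entry := τ.entry.trans (Equiv.swap i (i + 1))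
  row_lt b b' hr hc := by
    refine swap_lt (τ.row_lt b b' hr hc) fun ⟨h1, h2⟩ => h.1 ?_
    rw [row, row, ← h2, ← h1, Equiv.symm_apply_apply, Equiv.symm_apply_apply, hr]
  col_lt b b' hc hr := by
    refine swap_lt (τ.col_lt b b' hc hr) fun ⟨h1, h2⟩ => h.2 ?_
    rw [col, col, ← h2, ← h1, Equiv.symm_apply_apply, Equiv.symm_apply_apply, hc]

/-- The label `i + 1` lies strictly to the right of and strictly above the label `i`. This is the
condition for `s_i(τ) > τ` to be a cover in the order on tableaux. -/
def Ascent (τ : Tableau lam) (i : ℕ) : Prop :=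
  τ.col i < τ.col (i + 1) ∧ τ.row (i + 1) < τ.row i

theorem Ascent.swappable {τ : Tableau lam} {i : ℕ} (h : τ.Ascent i) : τ.Swappable i :=
  ⟨h.2.ne', h.1.ne⟩

/-- The tableaux that can be reached from `τ₀` by a sequence of `r` interchanges `s_i`. -/
inductive Reach (τ₀ : Tableau lam) : ℕ → Tableau lam → Prop
  | refl : Reach τ₀ 0 τ₀
  | step {r : ℕ} {τ : Tableau lam} (i : ℕ) (h : τ.Swappable i) :
      Reach τ₀ r τ → Reach τ₀ (r + 1) (τ.swap i h)

end Tableau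

/-! ### The column-standard tableau -/

/-- The number of boxes in the columns to the left of column `j`. -/
def colStart (lam : YoungDiagram) (j : ℕ) : ℕ := ∑ k ∈ Finset.range j, (lam.colLen k + 1)

theorem colStart_succ (j : ℕ) : colStart lam (j + 1) = colStart lam j + (lam.colLen j + 1) :=
  Finset.sum_range_succ _ _

theorem colStart_mono : Monotone (colStart lam) :=
  monotone_nat_of_le_succ fun j => by rw [colStart_succ]; omega

theorem mem_cells_iff {b : ℕ × ℕ} : b ∈ cells lam ↔ b.1 < lam.colLen b.2 + 1 := by
  obtain ⟨r, c⟩ := b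
  cases r with
  | zero => simp [cells]
  | succ r => simp [cells, YoungDiagram.mem_iff_lt_colLen]

theorem colStart_add_lt {b b' : cells lam} (h : b.1.2 < b'.1.2) :
    colStart lam b.1.2 + b.1.1 < colStart lam b'.1.2 + b'.1.1 := by
  have h1 := mem_cells_iff.1 b.2
  have h2 : colStart lam (b.1.2 + 1) ≤ colStart lam b'.1.2 := colStart_mono h
  rw [colStart_succ] at h2
  omega

theorem colStart_bijective :
    Function.Bijective fun b : cells lam => colStart lam b.1.2 + b.1.1 := by
  constructor
  · intro b b' h
    have h : colStart lam b.1.2 + b.1.1 = colStart lam b'.1.2 + b'.1.1 := h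
    have hc : b.1.2 = b'.1.2 := by
      rcases lt_trichotomy b.1.2 b'.1.2 with h' | h' | h'
      · exact absurd h (colStart_add_lt h').ne
      · exact h'
      · exact absurd h (colStart_add_lt h').ne'
    rw [hc] at h
    exact Subtype.ext (Prod.ext (by omega) hc)
  · intro n
    induction n with
    | zero => exact ⟨⟨(0, 0), Or.inl rfl⟩, by simp [colStart]⟩
    | succ n ih =>
      obtain ⟨⟨⟨r, c⟩, hb⟩, h⟩ := ih
      have hr : r < lam.colLen c + 1 := mem_cells_iff.1 hb
      have h : colStart lam c + r = n := h
      by_cases hr' : r + 1 < lam.colLen c + 1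
      · exact ⟨⟨(r + 1, c), mem_cells_iff.2 hr'⟩, by simp only; omega⟩
      · exact ⟨⟨(0, c + 1), Or.inl rfl⟩, by simp only [colStart_succ]; omega⟩

/-- The column-standard tableau `τ_λ`: the columns are filled one after the other, from left to
right, each from top to bottom. -/
def colTableau (lam : YoungDiagram) : Tableau lam where
  entry := Equiv.ofBijective _ (colStart_bijective (lam := lam))
  row_lt _ _ _ hc := colStart_add_lt hc
  col_lt b b' hc hr := by
    simp only [Equiv.ofBijective_apply, hc]
    omega

/-- The box directly below a given one has the next label; this characterizes `τ_λ`. -/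
theorem colTableau_below (b b' : cells lam) (hc : b'.1.2 = b.1.2) (hr : b'.1.1 = b.1.1 + 1) :
    (colTableau lam).entry b' = (colTableau lam).entry b + 1 := by
  simp only [colTableau, Equiv.ofBijective_apply, hc, hr]
  omega

/-- The inversion number of `τ`: the least number of interchanges `s_i`, all intermediate
tableaux being standard, that lead from the column-standard tableau to `τ`. -/
def inv (τ : Tableau lam) : ℕ := sInf {r | Tableau.Reach (colTableau lam) r τ}

/-! ### The Banach space and the operators -/

section Space

variable {F : Type*} [NontriviallyNormedField F]

/-- The Banach space of formal sums `∑ c_τ e_τ` with `c_τ → 0`, with the supremum norm: functions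
on the discrete set of tableaux that vanish at infinity. -/
abbrev Space (F : Type*) [NontriviallyNormedField F] (lam : YoungDiagram) : Type _ :=
  C₀(Tableau lam, F)

theorem tendsto_cofinite (f : Space F lam) : Tendsto f cofinite (𝓝 0) := by
  rw [← cocompact_eq_cofinite]
  exact f.zero_at_infty'

open Classical in
/-- The basis vector `e_τ`. -/
def e (τ : Tableau lam) : Space F lam where
  toFun σ := if σ = τ then 1 else 0
  continuous_toFun := continuous_of_discreteTopology
  zero_at_infty' := by
    rw [cocompact_eq_cofinite]
    refine tendsto_const_nhds.congr' ?_
    filter_upwards [(Set.finite_singleton τ).compl_mem_cofinite] with σ hσ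
    exact (if_neg hσ).symm

open Classical in
/-- The vector `T_i(e_τ)`. -/
def heckeBasis (t : F) (i : ℕ) (τ : Tableau lam) : Space F lam :=
  if hr : τ.row i = τ.row (i + 1) then e τ
  else if hc : τ.col i = τ.col (i + 1) then (-t) • e τ
  else if τ.Ascent i then
    e (τ.swap i ⟨hr, hc⟩) +
      ((1 - t) / (1 - t ^ (τ.content (i + 1) - τ.content i))) • e τ
  else
    (t * ((1 - t ^ (τ.content i - τ.content (i + 1) - 1)) *
        (1 - t ^ (τ.content i - τ.content (i + 1) + 1))) /
        (1 - t ^ (τ.content i - τ.content (i + 1))) ^ 2) • e (τ.swap i ⟨hr, hc⟩) -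
      (t ^ (τ.content i - τ.content (i + 1)) *
        ((1 - t) / (1 - t ^ (τ.content i - τ.content (i + 1))))) • e τ

/-! The operator `T_i` is the continuous extension `∑ c_τ e_τ ↦ ∑ c_τ T_i(e_τ)`. The following
facts show that the series converges and that the operator is bounded. -/

theorem norm_le_of_forall {f : Space F lam} {C : ℝ} (hC : 0 ≤ C) (h : ∀ τ, ‖f τ‖ ≤ C) :
    ‖f‖ ≤ C := by
  rw [← ZeroAtInftyContinuousMap.norm_toBCF_eq_norm]
  exact (BoundedContinuousFunction.norm_le hC).2 h

theorem norm_apply_le (f : Space F lam) (τ : Tableau lam) : ‖f τ‖ ≤ ‖f‖ := by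
  rw [← ZeroAtInftyContinuousMap.norm_toBCF_eq_norm]
  exact f.toBCF.norm_coe_le_norm τ

open Classical in
theorem norm_e_le (τ : Tableau lam) : ‖(e τ : Space F lam)‖ ≤ 1 := by
  refine norm_le_of_forall zero_le_one fun σ => ?_
  change ‖(if σ = τ then (1 : F) else 0)‖ ≤ 1
  split_ifs <;> simp

/-- A corner argument: in a standard tableau, `i + 1` is never strictly below and to the right
of `i`, nor strictly above and to the left. -/
theorem descent_of_not_ascent {τ : Tableau lam} {i : ℕ} (h : τ.Swappable i) (h' : ¬ τ.Ascent i) :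
    τ.col (i + 1) < τ.col i ∧ τ.row i < τ.row (i + 1) := by
  have key : ∀ m n : ℕ, τ.col m < τ.col n → τ.row m < τ.row n →
      m + 1 < n := by
    intro m n hc hr
    have hn := mem_cells_iff.1 (τ.entry.symm n).2
    let b : cells lam := ⟨(τ.row m, τ.col n), mem_cells_iff.2 (lt_trans hr hn)⟩
    have h1 := τ.row_lt (τ.entry.symm m) b rfl hc
    have h2 := τ.col_lt b (τ.entry.symm n) rfl hr
    rw [Equiv.apply_symm_apply] at h1 h2
    omega
  have k1 := key i (i + 1)
  have k2 := key (i + 1) i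
  have := h.1
  have := h.2
  unfold Tableau.Ascent at h'
  omega

theorem norm_zpow_lt_one {t : F} (h0 : 0 < ‖t‖) (h1 : ‖t‖ < 1) {d : ℤ} (hd : 0 < d) :
    ‖t ^ d‖ < 1 := by
  rw [norm_zpow]
  exact zpow_lt_one₀ h0 h1 hd

variable [IsUltrametricDist F]

instance : IsUltrametricDist (Space F lam) :=
  IsUltrametricDist.isUltrametricDist_of_isNonarchimedean_norm fun f g =>
    norm_le_of_forall (le_max_of_le_left (norm_nonneg f)) fun τ =>
      (IsUltrametricDist.norm_add_le_max (f τ) (g τ)).trans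
        (max_le_max (norm_apply_le f τ) (norm_apply_le g τ))

theorem norm_one_sub {x : F} (h : ‖x‖ < 1) : ‖1 - x‖ = 1 := by
  have h1 : ‖(1 : F)‖ ≠ ‖-x‖ := by rw [norm_one, norm_neg]; exact h.ne'
  rw [sub_eq_add_neg, IsUltrametricDist.norm_add_eq_max_of_norm_ne_norm h1, norm_one, norm_neg,
    max_eq_left h.le]

theorem norm_heckeBasis_le {t : F} (h0 : 0 < ‖t‖) (h1 : ‖t‖ < 1) (i : ℕ) (τ : Tableau lam) :
    ‖heckeBasis t i τ‖ ≤ 1 := by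
  have smul_le : ∀ (c : F) (σ : Tableau lam), ‖c‖ ≤ 1 → ‖c • (e σ : Space F lam)‖ ≤ 1 :=
    fun c σ hc => by
      rw [norm_smul]
      exact mul_le_one₀ hc (norm_nonneg _) (norm_e_le σ)
  have one {d : ℤ} (hd : 0 < d) : ‖1 - t ^ d‖ = 1 := norm_one_sub (norm_zpow_lt_one h0 h1 hd)
  unfold heckeBasis
  split_ifs with hr hc ha
  · exact norm_e_le τ
  · exact smul_le _ _ (by rw [norm_neg]; exact h1.le)
  · have hd : 0 < τ.content (i + 1) - τ.content i := by
      have := ha.1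
      have := ha.2
      simp only [Tableau.content]
      omega
    refine (IsUltrametricDist.norm_add_le_max _ _).trans (max_le (norm_e_le _) (smul_le _ _ ?_))
    rw [norm_div, one hd, norm_one_sub h1, div_one]
  · have hd : 1 < τ.content i - τ.content (i + 1) := by
      have := descent_of_not_ascent ⟨hr, hc⟩ ha
      simp only [Tableau.content]
      omega
    rw [sub_eq_add_neg]
    refine (IsUltrametricDist.norm_add_le_max _ _).trans (max_le (smul_le _ _ ?_) ?_)
    · rw [norm_div, norm_mul, norm_mul, norm_pow, one (by omega), one (by omega),
        one (by omega)]
      simpa using h1.le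
    · rw [norm_neg]
      refine smul_le _ _ ?_
      rw [norm_mul, norm_div, one (by omega), norm_one_sub h1, div_one, mul_one]
      exact (norm_zpow_lt_one h0 h1 (by omega)).le

variable [CompleteSpace F]

theorem summable_hecke {t : F} (h0 : 0 < ‖t‖) (h1 : ‖t‖ < 1) (i : ℕ) (f : Space F lam) :
    Summable fun τ => f τ • heckeBasis t i τ := by
  refine NonarchimedeanAddGroup.summable_of_tendsto_cofinite_zero ?_
  refine squeeze_zero_norm (fun τ => ?_) (tendsto_zero_iff_norm_tendsto_zero.1 (tendsto_cofinite f))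
  rw [norm_smul]
  exact mul_le_of_le_one_right (norm_nonneg _) (norm_heckeBasis_le h0 h1 i τ)

/-- The bounded operator `T_i`, for a pseudo-uniformizer `t`. -/
def T {t : F} (h0 : 0 < ‖t‖) (h1 : ‖t‖ < 1) (lam : YoungDiagram) (i : ℕ) :
    Space F lam →L[F] Space F lam :=
  LinearMap.mkContinuous
    { toFun := fun f => ∑' τ, f τ • heckeBasis t i τ
      map_add' := fun f g => by
        rw [← (summable_hecke h0 h1 i f).tsum_add (summable_hecke h0 h1 i g)]
        exact tsum_congr fun τ => add_smul (f τ) (g τ) (heckeBasis t i τ)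
      map_smul' := fun c f => by
        rw [RingHom.id_apply, ← (summable_hecke h0 h1 i f).tsum_const_smul c]
        simp only [ZeroAtInftyContinuousMap.smul_apply, smul_eq_mul, mul_smul] }
    1 fun f => by
      rw [one_mul]
      refine IsUltrametricDist.norm_tsum_le_of_forall_le_of_nonneg (norm_nonneg f) fun τ => ?_
      rw [norm_smul]
      exact (mul_le_of_le_one_right (norm_nonneg _) (norm_heckeBasis_le h0 h1 i τ)).trans
        (norm_apply_le f τ)

theorem T_apply {t : F} (h0 : 0 < ‖t‖) (h1 : ‖t‖ < 1) (i : ℕ) (f : Space F lam) :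
    T h0 h1 lam i f = ∑' τ, f τ • heckeBasis t i τ := rfl

open Classical in
theorem T_e {t : F} (h0 : 0 < ‖t‖) (h1 : ‖t‖ < 1) (i : ℕ) (τ : Tableau lam) :
    T h0 h1 lam i (e τ) = heckeBasis t i τ := by
  have h : ∀ σ : Tableau lam, (e τ : Space F lam) σ = if σ = τ then 1 else 0 := fun _ => rfl
  rw [T_apply, tsum_eq_single τ fun σ hσ => by rw [h, if_neg hσ, zero_smul], h, if_pos rfl,
    one_smul]

end Space

/-! ### Inner products and the weights -/

/-- An inner product on a Banach space over a non-archimedean field: a non-degenerate continuous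
symmetric bilinear form. -/
structure IsInnerProduct {F V : Type*} [NontriviallyNormedField F] [NormedAddCommGroup V]
    [NormedSpace F V] (B : LinearMap.BilinForm F V) : Prop where
  nondegenerate : B.Nondegenerate
  continuous : Continuous fun p : V × V => B p.1 p.2
  symm : B.IsSymm

/-- The bounded operator `A'` is the adjoint of the bounded operator `A` with respect to `B`. -/
def IsAdjoint {F V : Type*} [NontriviallyNormedField F] [NormedAddCommGroup V]
    [NormedSpace F V] (B : LinearMap.BilinForm F V) (A A' : V →L[F] V) : Prop :=
  ∀ v w : V, B (A v) w = B v (A' w)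

/-- The recursion that defines the weights `a(τ)`. -/
structure IsWeight {F : Type*} [NontriviallyNormedField F] (t : F)
    (a : Tableau lam → F) : Prop where
  base : a (colTableau lam) = 1
  step : ∀ (τ : Tableau lam) (i : ℕ) (h : τ.Ascent i),
    a (τ.swap i h.swappable) =
      (t ^ (τ.content (i + 1) - τ.content i) - t) *
          (t ^ (τ.content (i + 1) - τ.content i + 1) - 1) /
        (t ^ (τ.content (i + 1) - τ.content i) - 1) ^ 2 * a τ

/-- `B` is an inner product with `B (e_{τ_λ}, e_{τ_λ}) = 1` for which every `T_i` is its own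
adjoint. -/
structure IsHeckeForm {F : Type*} [NontriviallyNormedField F] [IsUltrametricDist F]
    [CompleteSpace F] {t : F} (h0 : 0 < ‖t‖) (h1 : ‖t‖ < 1)
    (B : LinearMap.BilinForm F (Space F lam)) : Prop where
  inner : IsInnerProduct B
  normalized : B (e (colTableau lam)) (e (colTableau lam)) = 1
  selfAdjoint : ∀ i : ℕ, IsAdjoint B (T h0 h1 lam i) (T h0 h1 lam i)

end InfHecke

end

noncomputable section

namespace InfHecke

variable {lam : YoungDiagram}

namespace Tableau

/-! ### Interchanging labels -/

/-! Combinatorics: an ascent adds exactly one inversion relative to `τ_λ`, inversion sets are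
finite, and only `τ_λ` has no descent. Hence ascents from `τ_λ` reach every tableau, `inv` counts
inversions, and a product over inversions solves the recursion for `a` without comparing different
paths (`isWeight_weight`). Each factor has norm `‖t‖`, so the weights are nonzero and bounded by 1.

Existence: the diagonal form with weights `a` is then continuous and non-degenerate, and the matrix
of each `T_i` is symmetric up to these weights (`IsWeight.heckeBasis_symm`).

Uniqueness: for any such form the Jucys–Murphy operators are self-adjoint. They act on `e_τ` by
powers of `t` given by the contents (`jucysMurphy_e`). Contents determine the tableau and `t` is not
a root of unity, so the `e_τ` are orthogonal. Self-adjointness of `T_i` at an ascent then forces the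
recursion for `(e_τ, e_τ)`, and continuity determines the form. -/

theorem entry_le_of_le (τ : Tableau lam) {b b' : cells lam} (hr : b.1.1 ≤ b'.1.1)
    (hc : b.1.2 ≤ b'.1.2) : τ.entry b ≤ τ.entry b' := by
  -- The corner box lies in the diagram because columns are initial segments.
  let m : cells lam := ⟨(b.1.1, b'.1.2), mem_cells_iff.2 (hr.trans_lt (mem_cells_iff.1 b'.2))⟩
  have h1 : τ.entry b ≤ τ.entry m := by
    rcases hc.lt_or_eq with h | h
    · exact (τ.row_lt b m rfl h).le
    · exact (congrArg τ.entry (Subtype.ext (Prod.ext rfl h) : b = m)).le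
  have h2 : τ.entry m ≤ τ.entry b' := by
    rcases hr.lt_or_eq with h | h
    · exact (τ.col_lt m b' rfl h).le
    · exact (congrArg τ.entry (Subtype.ext (Prod.ext h rfl) : m = b')).le
  exact h1.trans h2

theorem le_of_row_le_of_col_le (τ : Tableau lam) {m n : ℕ} (hr : τ.row m ≤ τ.row n)
    (hc : τ.col m ≤ τ.col n) : m ≤ n := by
  simpa using τ.entry_le_of_le hr hc

theorem ext_of_symm {σ τ : Tableau lam} (h : ∀ k, σ.entry.symm k = τ.entry.symm k) : σ = τ :=
  Tableau.ext (Equiv.symm_bijective.1 (Equiv.ext h))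

theorem row_swap (τ : Tableau lam) (i : ℕ) (h : τ.Swappable i) (k : ℕ) :
    (τ.swap i h).row k = τ.row (Equiv.swap i (i + 1) k) := rfl

theorem col_swap (τ : Tableau lam) (i : ℕ) (h : τ.Swappable i) (k : ℕ) :
    (τ.swap i h).col k = τ.col (Equiv.swap i (i + 1) k) := rfl

theorem content_swap (τ : Tableau lam) (i : ℕ) (h : τ.Swappable i) (k : ℕ) :
    (τ.swap i h).content k = τ.content (Equiv.swap i (i + 1) k) := rfl

theorem Swappable.swap {τ : Tableau lam} {i : ℕ} (h : τ.Swappable i) :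
    (τ.swap i h).Swappable i := by
  simpa [Swappable, row_swap, col_swap, eq_comm] using h

theorem swap_swap {τ : Tableau lam} {i : ℕ} (h : τ.Swappable i) (h' : (τ.swap i h).Swappable i) :
    (τ.swap i h).swap i h' = τ :=
  Tableau.ext (Equiv.ext fun b => by simp [swap])

theorem swap_ne {τ : Tableau lam} {i : ℕ} (h : τ.Swappable i) : τ.swap i h ≠ τ := fun h' => by
  have := τ.row_swap i h i
  rw [h', Equiv.swap_apply_left] at this
  exact h.1 this

theorem ascent_swap_iff {τ : Tableau lam} {i : ℕ} (h : τ.Swappable i) :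
    (τ.swap i h).Ascent i ↔ ¬ τ.Ascent i := by
  refine ⟨fun h1 h2 => ?_, fun h' => ?_⟩
  · simp only [Ascent, row_swap, col_swap, Equiv.swap_apply_left, Equiv.swap_apply_right] at h1 h2
    omega
  · simpa only [Ascent, row_swap, col_swap, Equiv.swap_apply_left, Equiv.swap_apply_right] using
      descent_of_not_ascent h h'

/-! ### Contents of standard tableaux -/

theorem Ascent.two_le {τ : Tableau lam} {i : ℕ} (h : τ.Ascent i) :
    2 ≤ τ.content (i + 1) - τ.content i := by
  have := h.1
  have := h.2
  simp only [content]
  omega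

theorem content_zero (τ : Tableau lam) : τ.content 0 = 0 := by
  let b : cells lam := ⟨(0, 0), Or.inl rfl⟩
  have h : τ.entry b ≤ τ.entry (τ.entry.symm 0) :=
    τ.entry_le_of_le (Nat.zero_le _) (Nat.zero_le _)
  rw [Equiv.apply_symm_apply, Nat.le_zero] at h
  have h' : τ.entry.symm 0 = b := by rw [← h, Equiv.symm_apply_apply]
  simp [content, row, col, h', b]

/-- Labels in adjacent positions of the same row have contents that differ by one. -/
theorem content_succ_of_row_eq {τ : Tableau lam} {i : ℕ} (h : τ.row i = τ.row (i + 1)) :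
    τ.content (i + 1) = τ.content i + 1 := by
  have h1 : τ.col i < τ.col (i + 1) := by
    by_contra! h'
    have := τ.le_of_row_le_of_col_le h.ge h'
    omega
  suffices h2 : τ.col (i + 1) = τ.col i + 1 by simp only [content, h, h2]; push_cast; ring
  by_contra h2
  -- If the boxes are not adjacent, the box just left of `i + 1` would carry a label strictly
  -- between `i` and `i + 1`.
  let b : cells lam := ⟨(τ.row (i + 1), τ.col (i + 1) - 1), by
    have h3 : (τ.row (i + 1), τ.col (i + 1)) ∈ cells lam := (τ.entry.symm (i + 1)).2
    rcases h3 with h3 | ⟨r, h3, h4⟩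
    · exact Or.inl h3
    · exact Or.inr ⟨r, h3, lam.up_left_mem le_rfl (Nat.sub_le _ _) h4⟩⟩
  have k1 := τ.row_lt (τ.entry.symm i) b h (by change τ.col i < τ.col (i + 1) - 1; omega)
  have k2 := τ.row_lt b (τ.entry.symm (i + 1)) rfl
    (by change τ.col (i + 1) - 1 < τ.col (i + 1); omega)
  rw [Equiv.apply_symm_apply] at k1 k2
  omega

/-- Labels in adjacent positions of the same column have contents that differ by one. -/
theorem content_succ_of_col_eq {τ : Tableau lam} {i : ℕ} (h : τ.col i = τ.col (i + 1)) :
    τ.content (i + 1) = τ.content i - 1 := by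
  have h1 : τ.row i < τ.row (i + 1) := by
    by_contra! h'
    have := τ.le_of_row_le_of_col_le h' h.ge
    omega
  suffices h2 : τ.row (i + 1) = τ.row i + 1 by simp only [content, h, h2]; push_cast; ring
  by_contra h2
  have h3 : τ.row (i + 1) < lam.colLen (τ.col (i + 1)) + 1 :=
    mem_cells_iff.1 (τ.entry.symm (i + 1)).2
  let b : cells lam := ⟨(τ.row i + 1, τ.col (i + 1)), mem_cells_iff.2 (by simp only; omega)⟩
  have k1 := τ.col_lt (τ.entry.symm i) b h (Nat.lt_succ_self (τ.row i))
  have k2 := τ.col_lt b (τ.entry.symm (i + 1)) rfl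
    (by change τ.row i + 1 < τ.row (i + 1); omega)
  rw [Equiv.apply_symm_apply] at k1 k2
  omega

/-- A standard tableau is determined by its sequence of contents. -/
theorem content_injective : Function.Injective (content : Tableau lam → ℕ → ℤ) := by
  -- Equal contents put the two boxes of `i` on one diagonal, so one is weakly above and left of the
  -- other. Its label in the other tableau is then at most `i`, and a smaller label is excluded
  -- because the earlier boxes agree.
  have key : ∀ (σ τ : Tableau lam) (i : ℕ), (∀ j < i, σ.entry.symm j = τ.entry.symm j) →
      σ.row i ≤ τ.row i → σ.col i ≤ τ.col i → σ.entry.symm i = τ.entry.symm i := by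
    intro σ τ i ih hr hc
    have h : τ.entry (σ.entry.symm i) ≤ τ.entry (τ.entry.symm i) := τ.entry_le_of_le hr hc
    rw [Equiv.apply_symm_apply] at h
    rcases h.lt_or_eq with h | h
    · have h' := ih _ h
      rw [Equiv.symm_apply_apply, EmbeddingLike.apply_eq_iff_eq] at h'
      omega
    · rw [Equiv.eq_symm_apply, h]
  intro σ τ h
  refine ext_of_symm fun i => ?_
  induction i using Nat.strong_induction_on with
  | _ i ih =>
    have hi := congrFun h i
    simp only [content] at hi
    rcases le_total (σ.row i) (τ.row i) with hr | hr
    · exact key σ τ i ih hr (by omega)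
    · exact (key τ σ i (fun j hj => (ih j hj).symm) hr (by omega)).symm

/-! ### Inversions -/

/-- The pairs of boxes of a tableau whose order with respect to the labels is opposite to their
order in the column-standard tableau. -/
def inversions (τ : Tableau lam) : Set (cells lam × cells lam) :=
  {p | p.2.1.2 < p.1.1.2 ∧ τ.entry p.1 < τ.entry p.2}

/-- The second box of an inversion lies to the left but has the larger label, so it cannot be in the
infinite row. This leaves finitely many second boxes, each preceded by finitely many labels. -/
theorem finite_inversions (τ : Tableau lam) : τ.inversions.Finite := by
  have hS : {b : cells lam | b.1.1 ≠ 0}.Finite := by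
    refine Set.Finite.of_injOn (f := fun b : cells lam => (b.1.1 - 1, b.1.2)) (t := lam.cells)
      ?_ ?_ lam.cells.finite_toSet
    · rintro ⟨⟨r, c⟩, hb⟩ h
      rcases hb with hb | ⟨r', hb, hb'⟩
      · exact absurd hb h
      · simp only at hb
        subst hb
        simpa using hb'
    · intro b hb b' hb' h
      simp only [Prod.mk.injEq] at h
      have h1 : b.1.1 ≠ 0 := hb
      have h2 : b'.1.1 ≠ 0 := hb'
      exact Subtype.ext (Prod.ext (by omega) h.2)
  refine (hS.biUnion fun b' _ => ((Set.finite_lt_nat (τ.entry b')).preimage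
    τ.entry.injective.injOn).image fun b => (b, b')).subset ?_
  rintro ⟨b, b'⟩ ⟨h1, h2⟩
  refine Set.mem_biUnion (x := b') (fun h0 => ?_) ⟨b, h2, rfl⟩
  exact h2.not_ge (τ.entry_le_of_le (h0.le.trans (Nat.zero_le _)) h1.le)

theorem Ascent.notMem_inversions {τ : Tableau lam} {i : ℕ} :
    (τ.entry.symm (i + 1), τ.entry.symm i) ∉ τ.inversions := fun h => by
  have := h.2
  simp only [Equiv.apply_symm_apply] at this
  omega

/-- Only the boxes labelled `i` and `i + 1` change their relative order; the column condition fixes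
how this pair is ordered. -/
theorem Ascent.inversions_swap {τ : Tableau lam} {i : ℕ} (h : τ.Ascent i) :
    (τ.swap i h.swappable).inversions =
      insert (τ.entry.symm (i + 1), τ.entry.symm i) τ.inversions := by
  ext ⟨b, b'⟩
  obtain ⟨m, rfl⟩ := τ.entry.symm.surjective b
  obtain ⟨n, rfl⟩ := τ.entry.symm.surjective b'
  have hc : τ.col i < τ.col (i + 1) := h.1
  have key : (τ.col n < τ.col m ∧ Equiv.swap i (i + 1) m < Equiv.swap i (i + 1) n) ↔
      ((m = i + 1 ∧ n = i) ∨ (τ.col n < τ.col m ∧ m < n)) := by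
    by_cases h1 : m = i + 1 ∧ n = i
    · obtain ⟨rfl, rfl⟩ := h1
      simpa using hc
    by_cases h2 : m = i ∧ n = i + 1
    · obtain ⟨rfl, rfl⟩ := h2
      simp only [Equiv.swap_apply_left, Equiv.swap_apply_right]
      omega
    simp only [h1, false_or, and_congr_right_iff]
    intro _
    simp only [Equiv.swap_apply_def]
    split_ifs <;> omega
  simpa [inversions, swap, col] using key

theorem Ascent.ncard_inversions_swap {τ : Tableau lam} {i : ℕ} (h : τ.Ascent i) :
    (τ.swap i h.swappable).inversions.ncard = τ.inversions.ncard + 1 := by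
  rw [h.inversions_swap, Set.ncard_insert_of_notMem notMem_inversions τ.finite_inversions]

theorem inversions_colTableau : (colTableau lam).inversions = ∅ := by
  refine Set.eq_empty_of_forall_notMem fun p ⟨h1, h2⟩ => ?_
  have h3 : (colTableau lam).entry p.2 < (colTableau lam).entry p.1 := colStart_add_lt h1
  exact h2.not_gt h3

/-- A tableau whose labels move weakly to the right is column-standard. -/
theorem eq_colTableau_of_monotone_col {τ : Tableau lam} (h : Monotone τ.col) :
    τ = colTableau lam := by
  have hm : StrictMono (τ.entry.symm.trans (colTableau lam).entry) := by
    intro m n hmn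
    rcases (h hmn.le).lt_or_eq with hc | hc
    · exact colStart_add_lt hc
    · refine (colTableau lam).col_lt _ _ hc ?_
      by_contra! hr
      have := τ.le_of_row_le_of_col_le hr hc.ge
      omega
  -- The identity is the only order automorphism of `ℕ`.
  have hs : hm.orderIsoOfSurjective _ (Equiv.surjective _) = OrderIso.refl ℕ :=
    Subsingleton.elim _ _
  refine Tableau.ext (Equiv.ext fun b => ?_)
  have := DFunLike.congr_fun hs (τ.entry b)
  simpa using this.symm

/-- Otherwise the labels never move left: a move to the left from `i` to `i + 1` cannot stay in one
row, so it is a descent. -/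
theorem exists_descent {τ : Tableau lam} (h : τ ≠ colTableau lam) :
    ∃ i, τ.Swappable i ∧ ¬ τ.Ascent i := by
  by_contra! hd
  refine h (eq_colTableau_of_monotone_col (monotone_nat_of_le_succ fun i => ?_))
  by_contra! hc
  have hr : τ.row i ≠ τ.row (i + 1) := fun hr => by
    have := τ.le_of_row_le_of_col_le hr.ge hc.le
    omega
  exact (hd i ⟨hr, hc.ne'⟩).1.not_gt hc

/-- Every tableau is obtained from the column-standard one by ascents. -/
theorem ascent_induction {P : Tableau lam → Prop} (base : P (colTableau lam))
    (step : ∀ (τ : Tableau lam) (i : ℕ) (h : τ.Ascent i), P τ → P (τ.swap i h.swappable))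
    (τ : Tableau lam) : P τ := by
  -- Undoing a descent removes one inversion.
  induction hn : τ.inversions.ncard using Nat.strong_induction_on generalizing τ with
  | _ n ih =>
    by_cases hτ : τ = colTableau lam
    · rwa [hτ]
    obtain ⟨i, h, h'⟩ := exists_descent hτ
    have ha := (ascent_swap_iff h).2 h'
    have hc := ha.ncard_inversions_swap
    rw [swap_swap] at hc
    have := step _ i ha (ih _ (by omega) _ rfl)
    rwa [swap_swap] at this

/-- Each interchange is an ascent or the reverse of one, so it changes the number of inversions by
exactly one. -/
theorem Reach.ncard_inversions_le {r : ℕ} {τ : Tableau lam} (h : Reach (colTableau lam) r τ) :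
    τ.inversions.ncard ≤ r := by
  induction h with
  | refl => simp [inversions_colTableau]
  | @step r τ i h _ ih =>
    by_cases ha : τ.Ascent i
    · rw [ha.ncard_inversions_swap]
      omega
    · have hc := ((ascent_swap_iff h).2 ha).ncard_inversions_swap
      rw [swap_swap] at hc
      omega

theorem reach_ncard_inversions (τ : Tableau lam) :
    Reach (colTableau lam) τ.inversions.ncard τ := by
  induction τ using ascent_induction with
  | base => simpa [inversions_colTableau] using Reach.refl
  | step τ i h ih =>
    rw [h.ncard_inversions_swap]
    exact ih.step i h.swappable

theorem inv_eq_ncard_inversions (τ : Tableau lam) : inv τ = τ.inversions.ncard :=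
  le_antisymm (Nat.sInf_le τ.reach_ncard_inversions)
    (le_csInf ⟨_, τ.reach_ncard_inversions⟩ fun _ h => h.ncard_inversions_le)

end Tableau

/-! ### The weights -/

section Weight

variable {F : Type*} [NontriviallyNormedField F]

/-- The factor by which the weight changes at an ascent. -/
def weightFactor (t : F) (d : ℤ) : F := (t ^ d - t) * (t ^ (d + 1) - 1) / (t ^ d - 1) ^ 2

/-- The weight of a tableau, a product over its inversions. -/
def weight (t : F) (τ : Tableau lam) : F :=
  ∏ᶠ p ∈ τ.inversions,
    weightFactor t (((p.1.1.2 : ℤ) - (p.1.1.1 : ℤ)) - ((p.2.1.2 : ℤ) - (p.2.1.1 : ℤ)))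

theorem isWeight_weight (t : F) : IsWeight t (weight t : Tableau lam → F) where
  base := by simp [weight, Tableau.inversions_colTableau]
  step τ i h := by
    rw [weight, h.inversions_swap,
      finprod_mem_insert _ Tableau.Ascent.notMem_inversions τ.finite_inversions]
    rfl

theorem IsWeight.unique {t : F} {a b : Tableau lam → F} (ha : IsWeight t a) (hb : IsWeight t b) :
    a = b := by
  funext τ
  induction τ using Tableau.ascent_induction with
  | base => rw [ha.base, hb.base]
  | step τ i h ih => rw [ha.step τ i h, hb.step τ i h, ih]

/-- After extracting `t` from `t ^ d - t`, only differences of 1 and positive powers of `t` remain,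
all of norm 1; `2 ≤ d` makes `d - 1` positive. -/
theorem norm_weightFactor [IsUltrametricDist F] {t : F} (h0 : 0 < ‖t‖) (h1 : ‖t‖ < 1) {d : ℤ}
    (hd : 2 ≤ d) : ‖weightFactor t d‖ = ‖t‖ := by
  have ht : t ≠ 0 := norm_pos_iff.1 h0
  have one {d : ℤ} (hd : 0 < d) : ‖t ^ d - 1‖ = 1 := by
    rw [norm_sub_rev, norm_one_sub (norm_zpow_lt_one h0 h1 hd)]
  have h : t ^ d - t = t * (t ^ (d - 1) - 1) := by
    rw [mul_sub, mul_one, ← zpow_one_add₀ ht, add_sub_cancel]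
  rw [weightFactor, h, norm_div, norm_mul, norm_mul, norm_pow, one (by omega), one (by omega),
    one (by omega)]
  simp

theorem IsWeight.norm_eq [IsUltrametricDist F] {t : F} (h0 : 0 < ‖t‖) (h1 : ‖t‖ < 1)
    {a : Tableau lam → F} (ha : IsWeight t a) (τ : Tableau lam) : ‖a τ‖ = ‖t‖ ^ inv τ := by
  rw [Tableau.inv_eq_ncard_inversions]
  induction τ using Tableau.ascent_induction with
  | base => simp [ha.base, Tableau.inversions_colTableau]
  | step τ i h ih =>
    rw [ha.step τ i h, ← weightFactor, norm_mul, norm_weightFactor h0 h1 h.two_le, ih,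
      h.ncard_inversions_swap, pow_succ']

end Weight

section Form

variable {F : Type*} [NontriviallyNormedField F]

/-! ### Expansions in the basis vectors -/

theorem e_apply_self (τ : Tableau lam) : (e τ : Space F lam) τ = 1 := if_pos rfl

theorem e_apply_of_ne {τ σ : Tableau lam} (h : σ ≠ τ) : (e τ : Space F lam) σ = 0 := if_neg h

/-- The coefficient of `e_τ`, as a continuous functional. -/
def coeff (τ : Tableau lam) : Space F lam →L[F] F :=
  LinearMap.mkContinuous
    { toFun := fun f => f τ
      map_add' := fun _ _ => rfl
      map_smul' := fun _ _ => rfl }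
    1 fun f => by simpa using norm_apply_le f τ

theorem coeff_apply (τ : Tableau lam) (f : Space F lam) : coeff τ f = f τ := rfl

/-- The action of `T_i` on the basis vector of a tableau with an ascent at `i`. -/
theorem heckeBasis_ascent (t : F) {i : ℕ} {τ : Tableau lam} (h : τ.Ascent i) :
    heckeBasis t i τ = e (τ.swap i h.swappable) +
      ((1 - t) / (1 - t ^ (τ.content (i + 1) - τ.content i))) • e τ := by
  rw [heckeBasis, dif_neg h.swappable.1, dif_neg h.swappable.2, if_pos h]

theorem heckeBasis_swap_ascent (t : F) {i : ℕ} {τ : Tableau lam} (h : τ.Ascent i) :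
    heckeBasis t i (τ.swap i h.swappable) =
      (t * ((1 - t ^ (τ.content (i + 1) - τ.content i - 1)) *
        (1 - t ^ (τ.content (i + 1) - τ.content i + 1))) /
        (1 - t ^ (τ.content (i + 1) - τ.content i)) ^ 2) • e τ -
      (t ^ (τ.content (i + 1) - τ.content i) *
        ((1 - t) / (1 - t ^ (τ.content (i + 1) - τ.content i)))) •
          e (τ.swap i h.swappable) := by
  have h' := h.swappable.swap
  have ha : ¬ (τ.swap i h.swappable).Ascent i := fun h2 =>
    (Tableau.ascent_swap_iff h.swappable).1 h2 h
  rw [heckeBasis, dif_neg h'.1, dif_neg h'.2, if_neg ha, Tableau.swap_swap h.swappable h']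
  simp only [Tableau.content_swap, Equiv.swap_apply_left, Equiv.swap_apply_right]

theorem heckeBasis_row (t : F) {i : ℕ} {τ : Tableau lam} (h : τ.row i = τ.row (i + 1)) :
    heckeBasis t i τ = e τ := dif_pos h

theorem heckeBasis_col (t : F) {i : ℕ} {τ : Tableau lam} (h : τ.col i = τ.col (i + 1)) :
    heckeBasis t i τ = (-t) • e τ := by
  have hr : τ.row i ≠ τ.row (i + 1) := fun hr => by
    have := τ.le_of_row_le_of_col_le hr.ge h.ge
    omega
  rw [heckeBasis, dif_neg hr, dif_pos h]

theorem heckeBasis_apply_eq_zero (t : F) {i : ℕ} {σ τ : Tableau lam} (h : τ ≠ σ)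
    (h' : ∀ hs : σ.Swappable i, τ ≠ σ.swap i hs) : heckeBasis t i σ τ = 0 := by
  unfold heckeBasis
  split_ifs with hr hc ha
  · exact e_apply_of_ne h
  · simp [e_apply_of_ne h]
  · simp [e_apply_of_ne h, e_apply_of_ne (h' ⟨hr, hc⟩)]
  · simp [e_apply_of_ne h, e_apply_of_ne (h' ⟨hr, hc⟩)]

theorem mul_one_sub_zpow {t : F} (ht : t ≠ 0) (d : ℤ) : t * (1 - t ^ (d - 1)) = t - t ^ d := by
  rw [mul_sub, mul_one, ← zpow_one_add₀ ht, add_sub_cancel]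

/-- The matrix of `T_i` is symmetric up to the weights. -/
theorem IsWeight.heckeBasis_symm {t : F} (ht : t ≠ 0) {a : Tableau lam → F} (ha : IsWeight t a)
    (i : ℕ) (σ τ : Tableau lam) : heckeBasis t i σ τ * a τ = heckeBasis t i τ σ * a σ := by
  have asc : ∀ (σ : Tableau lam) (h : σ.Ascent i),
      heckeBasis t i σ (σ.swap i h.swappable) * a (σ.swap i h.swappable) =
        heckeBasis t i (σ.swap i h.swappable) σ * a σ := by
    intro σ h
    have hne := Tableau.swap_ne h.swappable
    have h1 : heckeBasis t i σ (σ.swap i h.swappable) = 1 := by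
      simp [heckeBasis_ascent t h, e_apply_self, e_apply_of_ne hne]
    rw [h1, one_mul, ha.step σ i h]
    simp only [heckeBasis_swap_ascent t h, ZeroAtInftyContinuousMap.sub_apply,
      ZeroAtInftyContinuousMap.smul_apply, e_apply_self, e_apply_of_ne hne.symm, smul_eq_mul,
      mul_one, mul_zero, sub_zero]
    rw [← mul_assoc, mul_one_sub_zpow ht, ← neg_sub (t ^ _) t, ← neg_sub (t ^ (_ + 1)) 1,
      neg_mul_neg, sub_sq_comm]
  rcases eq_or_ne τ σ with rfl | hne
  · rfl
  -- Off the diagonal only interchanged pairs matter, and one member of such a pair has an ascent.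
  by_cases hs : ∃ h : σ.Swappable i, τ = σ.swap i h
  · obtain ⟨h, rfl⟩ := hs
    by_cases h' : σ.Ascent i
    · exact asc σ h'
    · have := asc _ ((Tableau.ascent_swap_iff h).2 h')
      simp only [Tableau.swap_swap] at this
      exact this.symm
  · push Not at hs
    rw [heckeBasis_apply_eq_zero t hne hs, heckeBasis_apply_eq_zero t hne.symm, zero_mul, zero_mul]
    rintro h rfl
    exact hs h.swap (Tableau.swap_swap h _).symm

theorem zpow_injective_of_norm {t : F} (h0 : 0 < ‖t‖) (h1 : ‖t‖ < 1) :
    Function.Injective fun d : ℤ => t ^ d := fun d d' h => by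
  have h' := congrArg norm h
  simp only [norm_zpow] at h'
  exact zpow_right_injective₀ h0 h1.ne h'

theorem norm_mul_mul_le {a : Tableau lam → F} (ha : ∀ τ, ‖a τ‖ ≤ 1) (v w : Space F lam)
    (τ : Tableau lam) : ‖v τ * w τ * a τ‖ ≤ ‖v τ‖ * ‖w‖ := by
  rw [norm_mul, norm_mul]
  exact (mul_le_of_le_one_right (by positivity) (ha τ)).trans
    (mul_le_mul_of_nonneg_left (norm_apply_le w τ) (norm_nonneg _))

variable [IsUltrametricDist F]

theorem one_sub_zpow_ne_zero {t : F} (h0 : 0 < ‖t‖) (h1 : ‖t‖ < 1) {d : ℤ} (hd : 0 < d) :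
    1 - t ^ d ≠ 0 := by
  rw [← norm_ne_zero_iff, norm_one_sub (norm_zpow_lt_one h0 h1 hd)]
  exact one_ne_zero

variable [CompleteSpace F]

theorem hasSum_smul_e (f : Space F lam) : HasSum (fun τ => f τ • (e τ : Space F lam)) f := by
  have hs : Summable fun τ => f τ • (e τ : Space F lam) := by
    refine NonarchimedeanAddGroup.summable_of_tendsto_cofinite_zero ?_
    refine squeeze_zero_norm (fun τ => ?_)
      (tendsto_zero_iff_norm_tendsto_zero.1 (tendsto_cofinite f))
    rw [norm_smul]
    exact mul_le_of_le_one_right (norm_nonneg _) (norm_e_le τ)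
  convert hs.hasSum
  ext σ
  -- The limit is identified coordinatewise, by the continuous coefficient functionals.
  rw [← coeff_apply, ← coeff_apply, (coeff σ).map_tsum hs, tsum_eq_single σ]
  · simp [coeff_apply, e_apply_self]
  · intro τ hτ
    simp [coeff_apply, e_apply_of_ne hτ.symm]

/-- Continuous linear maps on the space of formal sums are determined on the basis vectors. -/
theorem continuousLinearMap_ext {W : Type*} [NormedAddCommGroup W] [NormedSpace F W]
    {A A' : Space F lam →L[F] W} (h : ∀ τ, A (e τ) = A' (e τ)) : A = A' := by
  ext v
  have h1 := (hasSum_smul_e v).mapL A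
  have h2 := (hasSum_smul_e v).mapL A'
  simp only [map_smul, h] at h1 h2
  exact h1.unique h2

/-! ### The form attached to a bounded weight -/

theorem summable_mul_mul {a : Tableau lam → F} (ha : ∀ τ, ‖a τ‖ ≤ 1) (v w : Space F lam) :
    Summable fun τ => v τ * w τ * a τ := by
  refine NonarchimedeanAddGroup.summable_of_tendsto_cofinite_zero ?_
  refine squeeze_zero_norm (norm_mul_mul_le ha v w) ?_
  simpa using (tendsto_zero_iff_norm_tendsto_zero.1 (tendsto_cofinite v)).mul_const ‖w‖

/-- The diagonal form with a bounded weight. -/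
def weightForm {a : Tableau lam → F} (ha : ∀ τ, ‖a τ‖ ≤ 1) :
    Space F lam →L[F] Space F lam →L[F] F :=
  LinearMap.mkContinuous₂
    (LinearMap.mk₂ F (fun v w => ∑' τ, v τ * w τ * a τ)
      (fun v v' w => by
        rw [← (summable_mul_mul ha v w).tsum_add (summable_mul_mul ha v' w)]
        exact tsum_congr fun τ => by rw [ZeroAtInftyContinuousMap.add_apply]; ring)
      (fun c v w => by
        rw [smul_eq_mul, ← tsum_mul_left]
        exact tsum_congr fun τ => by
          rw [ZeroAtInftyContinuousMap.smul_apply, smul_eq_mul]; ring)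
      (fun v w w' => by
        rw [← (summable_mul_mul ha v w).tsum_add (summable_mul_mul ha v w')]
        exact tsum_congr fun τ => by rw [ZeroAtInftyContinuousMap.add_apply]; ring)
      (fun c v w => by
        rw [smul_eq_mul, ← tsum_mul_left]
        exact tsum_congr fun τ => by
          rw [ZeroAtInftyContinuousMap.smul_apply, smul_eq_mul]; ring))
    1 fun v w => by
      rw [one_mul]
      refine IsUltrametricDist.norm_tsum_le_of_forall_le_of_nonneg (by positivity) fun τ => ?_
      exact (norm_mul_mul_le ha v w τ).trans
        (mul_le_mul_of_nonneg_right (norm_apply_le v τ) (norm_nonneg _))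

theorem weightForm_apply {a : Tableau lam → F} (ha : ∀ τ, ‖a τ‖ ≤ 1) (v w : Space F lam) :
    weightForm ha v w = ∑' τ, v τ * w τ * a τ := rfl

theorem weightForm_e_right {a : Tableau lam → F} (ha : ∀ τ, ‖a τ‖ ≤ 1) (v : Space F lam)
    (τ : Tableau lam) : weightForm ha v (e τ) = v τ * a τ := by
  rw [weightForm_apply, tsum_eq_single τ fun σ hσ => by rw [e_apply_of_ne hσ]; ring, e_apply_self,
    mul_one]

theorem weightForm_comm {a : Tableau lam → F} (ha : ∀ τ, ‖a τ‖ ≤ 1) (v w : Space F lam) :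
    weightForm ha v w = weightForm ha w v := by
  simp only [weightForm_apply, mul_comm (v _)]

theorem isHeckeForm_weightForm {t : F} (h0 : 0 < ‖t‖) (h1 : ‖t‖ < 1) {a : Tableau lam → F}
    (hw : IsWeight t a) (hne : ∀ τ, a τ ≠ 0) (ha : ∀ τ, ‖a τ‖ ≤ 1) :
    IsHeckeForm h0 h1 (weightForm ha).toLinearMap₁₂ where
  inner :=
    { nondegenerate := by
        have key : ∀ v : Space F lam, (∀ w, weightForm ha v w = 0) → v = 0 := fun v hv => by
          ext τ
          have := hv (e τ)
          rw [weightForm_e_right] at this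
          exact (mul_eq_zero.1 this).resolve_right (hne τ)
        exact ⟨key, fun w hw => key w fun v => by rw [weightForm_comm]; exact hw v⟩
      continuous := (weightForm ha).continuous₂
      symm := ⟨weightForm_comm ha⟩ }
  normalized := by
    change weightForm ha _ _ = 1
    rw [weightForm_e_right, e_apply_self, hw.base, one_mul]
  selfAdjoint i v w := by
    -- Both sides of the adjointness relation are continuous maps into the dual, so comparing them
    -- on pairs of basis vectors suffices.
    have h : (weightForm ha).comp (T h0 h1 lam i) =
        ((weightForm ha).flip.comp (T h0 h1 lam i)).flip := by
      refine continuousLinearMap_ext (F := F) (lam := lam) fun σ =>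
        continuousLinearMap_ext (F := F) (lam := lam) (W := F) fun τ => ?_
      change weightForm ha (T h0 h1 lam i (e σ)) (e τ) = weightForm ha (e σ) (T h0 h1 lam i (e τ))
      rw [weightForm_comm ha (e σ), weightForm_e_right, weightForm_e_right, T_e, T_e]
      exact hw.heckeBasis_symm (norm_pos_iff.1 h0) i σ τ
    exact DFunLike.congr_fun (DFunLike.congr_fun h v) w

/-! ### Jucys–Murphy operators and uniqueness -/

/-- The Jucys–Murphy operators. -/
def jucysMurphy {t : F} (h0 : 0 < ‖t‖) (h1 : ‖t‖ < 1) (lam : YoungDiagram) :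
    ℕ → Space F lam →L[F] Space F lam
  | 0 => ContinuousLinearMap.id F _
  | i + 1 => t⁻¹ • (T h0 h1 lam i).comp ((jucysMurphy h0 h1 lam i).comp (T h0 h1 lam i))

theorem jucysMurphy_succ_apply {t : F} (h0 : 0 < ‖t‖) (h1 : ‖t‖ < 1) (i : ℕ) (v : Space F lam) :
    jucysMurphy h0 h1 lam (i + 1) v =
      t⁻¹ • T h0 h1 lam i (jucysMurphy h0 h1 lam i (T h0 h1 lam i v)) := rfl

/-- The basis vectors are joint eigenvectors of the Jucys–Murphy operators; the eigenvalues are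
given by the contents. -/
theorem jucysMurphy_e {t : F} (h0 : 0 < ‖t‖) (h1 : ‖t‖ < 1) (i : ℕ) (τ : Tableau lam) :
    jucysMurphy h0 h1 lam i (e τ) = t ^ (-τ.content i) • (e τ : Space F lam) := by
  have ht : t ≠ 0 := norm_pos_iff.1 h0
  induction i generalizing τ with
  | zero => simp [jucysMurphy, τ.content_zero]
  | succ i ih =>
    -- `T_i` mixes `e_τ` with the interchanged vector, so both are treated together. With `d`
    -- abstracted, each coefficient becomes a rational identity in `t`, `t ^ d` and a power of `t`
    -- from the content of `i`.
    have asc : ∀ (τ : Tableau lam) (h : τ.Ascent i),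
        (jucysMurphy h0 h1 lam (i + 1) (e τ) = t ^ (-τ.content (i + 1)) • (e τ : Space F lam)) ∧
        (jucysMurphy h0 h1 lam (i + 1) (e (τ.swap i h.swappable)) =
          t ^ (-τ.content i) • (e (τ.swap i h.swappable) : Space F lam)) := by
      intro τ h
      have hd := one_sub_zpow_ne_zero h0 h1 (two_pos.trans_le h.two_le)
      obtain ⟨d, hd'⟩ : ∃ d, d = τ.content (i + 1) - τ.content i := ⟨_, rfl⟩
      have hc : τ.content (i + 1) = τ.content i + d := by omega
      rw [← hd'] at hd
      have ih1 := ih τ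
      have ih2 := ih (τ.swap i h.swappable)
      rw [Tableau.content_swap, Equiv.swap_apply_left, hc] at ih2
      have hT := heckeBasis_ascent t h
      have hT' := heckeBasis_swap_ascent t h
      rw [← hd'] at hT hT'
      rw [hc]
      have e1 : t ^ (d - 1) = t ^ d * t⁻¹ := zpow_sub_one₀ ht d
      have e2 : t ^ (d + 1) = t ^ d * t := zpow_add_one₀ ht d
      have e3 : t ^ (-(τ.content i + d)) = t ^ (-τ.content i) * (t ^ d)⁻¹ := by
        rw [neg_add, zpow_add₀ ht, zpow_neg t d]
      have hx : t ^ d ≠ 0 := zpow_ne_zero d ht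
      rw [e1, e2] at hT'
      rw [e3] at ih2 ⊢
      constructor
      · simp only [jucysMurphy_succ_apply, T_e, hT, hT', map_add, map_smul, ih1, ih2]
        match_scalars
        · field_simp
          ring
        · field_simp
          ring
      · simp only [jucysMurphy_succ_apply, T_e, hT, hT', map_sub, map_smul, ih1, ih2]
        match_scalars
        · field_simp
          ring
        · field_simp
          ring
    -- The eigenvalue gains `t⁻¹` along a row and `t⁻¹ * (-t) ^ 2 = t` down a column, as the content
    -- changes by `1` or `-1`.
    by_cases hr : τ.row i = τ.row (i + 1)
    · rw [jucysMurphy_succ_apply, T_e, heckeBasis_row t hr, ih, map_smul, T_e,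
        heckeBasis_row t hr, smul_smul, Tableau.content_succ_of_row_eq hr, neg_add,
        zpow_add₀ ht, zpow_neg_one, mul_comm]
    by_cases hc : τ.col i = τ.col (i + 1)
    · rw [jucysMurphy_succ_apply, T_e, heckeBasis_col t hc, map_smul, ih, map_smul, map_smul, T_e,
        heckeBasis_col t hc, Tableau.content_succ_of_col_eq hc, neg_sub', sub_neg_eq_add,
        zpow_add₀ ht, zpow_one]
      match_scalars
      field_simp
    have hs : τ.Swappable i := ⟨hr, hc⟩
    by_cases h : τ.Ascent i
    · exact (asc τ h).1
    · have := (asc _ ((Tableau.ascent_swap_iff hs).2 h)).2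
      rwa [Tableau.swap_swap, Tableau.content_swap, Equiv.swap_apply_left] at this

namespace IsHeckeForm

variable {t : F} {h0 : 0 < ‖t‖} {h1 : ‖t‖ < 1} {B : LinearMap.BilinForm F (Space F lam)}

/-- The product `T_i L_i T_i` is a palindrome in self-adjoint operators. -/
theorem isAdjoint_jucysMurphy (hB : IsHeckeForm h0 h1 B) (i : ℕ) :
    IsAdjoint B (jucysMurphy h0 h1 lam i) (jucysMurphy h0 h1 lam i) := by
  induction i with
  | zero => exact fun _ _ => rfl
  | succ i ih =>
    intro v w
    rw [jucysMurphy_succ_apply, jucysMurphy_succ_apply, LinearMap.BilinForm.smul_left,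
      LinearMap.BilinForm.smul_right, hB.selfAdjoint i, ih, hB.selfAdjoint i]

/-- Eigenvectors of a self-adjoint operator with distinct eigenvalues are orthogonal; some
Jucys–Murphy operator separates `σ` from `τ`. -/
theorem apply_e_of_ne (hB : IsHeckeForm h0 h1 B) {σ τ : Tableau lam} (h : σ ≠ τ) :
    B (e σ) (e τ) = 0 := by
  obtain ⟨i, hi⟩ := Function.ne_iff.1 (Tableau.content_injective.ne h)
  have h2 := hB.isAdjoint_jucysMurphy i (e σ) (e τ)
  rw [jucysMurphy_e, jucysMurphy_e, LinearMap.BilinForm.smul_left, LinearMap.BilinForm.smul_right,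
    ← sub_eq_zero, ← sub_mul] at h2
  refine (mul_eq_zero.1 h2).resolve_left (sub_ne_zero.2 fun h3 => hi ?_)
  exact neg_injective (zpow_injective_of_norm h0 h1 h3)

/-- By orthogonality, moving `T_i` across the pairing of `e_τ` with the interchanged vector leaves
one diagonal term on each side. -/
theorem isWeight (hB : IsHeckeForm h0 h1 B) :
    IsWeight t fun τ : Tableau lam => B (e τ) (e τ) where
  base := hB.normalized
  step τ i h := by
    have hne := Tableau.swap_ne h.swappable
    have h2 := hB.selfAdjoint i (e τ) (e (τ.swap i h.swappable))
    rw [T_e, T_e, heckeBasis_ascent t h, heckeBasis_swap_ascent t h] at h2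
    simp only [map_add, map_sub, map_smul, LinearMap.add_apply, LinearMap.smul_apply,
      hB.apply_e_of_ne hne.symm, add_zero, sub_zero, smul_eq_mul, mul_zero] at h2
    rw [h2, ← mul_assoc t, mul_one_sub_zpow (norm_pos_iff.1 h0), ← neg_sub (t ^ _) t,
      ← neg_sub (t ^ (_ + 1)) 1, neg_mul_neg, sub_sq_comm]

theorem hasSum (hB : IsHeckeForm h0 h1 B) {a : Tableau lam → F} (ha : IsWeight t a)
    (v w : Space F lam) : HasSum (fun τ => v τ * w τ * a τ) (B v w) := by
  obtain rfl := hB.isWeight.unique ha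
  have cl : ∀ w : Space F lam, Continuous fun v => B v w := fun w =>
    hB.inner.continuous.comp (continuous_id.prodMk continuous_const)
  have cr : ∀ v : Space F lam, Continuous fun w => B v w := fun v =>
    hB.inner.continuous.comp (continuous_const.prodMk continuous_id)
  have h : ∀ τ, B (e τ) w = w τ * B (e τ) (e τ) := fun τ => by
    have h2 := (hasSum_smul_e w).map (B (e τ)) (cr (e τ))
    refine h2.unique ?_
    convert hasSum_single τ _ using 1
    · simp
    · intro σ hσ
      simp [hB.apply_e_of_ne hσ.symm]
  -- After the expansion of `w`, that of `v` reduces the form to its diagonal values.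
  have h3 : HasSum (fun τ => B (v τ • e τ) w) (B v w) :=
    (hasSum_smul_e v).map (B.flip w) (cl w)
  simpa [h, mul_assoc] using h3

end IsHeckeForm

end Form

end InfHecke

end

theorem mainTheorem4 {F : Type*} [NontriviallyNormedField F] [IsUltrametricDist F]
    [CompleteSpace F] (t : F) (h0 : 0 < ‖t‖) (h1 : ‖t‖ < 1) (lam : YoungDiagram) :
    (∃! B : LinearMap.BilinForm F (InfHecke.Space F lam), InfHecke.IsHeckeForm h0 h1 B) ∧
    (∃! a : InfHecke.Tableau lam → F, InfHecke.IsWeight t a) ∧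
    (∀ a : InfHecke.Tableau lam → F, InfHecke.IsWeight t a →
      (∀ τ : InfHecke.Tableau lam, ‖a τ‖ = ‖t‖ ^ InfHecke.inv τ) ∧
      ∀ B : LinearMap.BilinForm F (InfHecke.Space F lam), InfHecke.IsHeckeForm h0 h1 B →
        ∀ v w : InfHecke.Space F lam, HasSum (fun τ => v τ * w τ * a τ) (B v w)) := by
  have hw := InfHecke.isWeight_weight (lam := lam) t
  have hn := hw.norm_eq h0 h1
  refine ⟨?_, ⟨_, hw, fun a ha => ha.unique hw⟩, fun a ha =>
    ⟨ha.norm_eq h0 h1, fun B hB => hB.hasSum ha⟩⟩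
  have hform := InfHecke.isHeckeForm_weightForm h0 h1 hw
    (fun τ => by
      rw [← norm_ne_zero_iff, hn]
      exact (pow_pos h0 _).ne')
    (fun τ => by
      rw [hn]
      exact pow_le_one₀ h0.le h1.le)
  exact ⟨_, hform, fun B hB => LinearMap.ext fun v => LinearMap.ext fun w =>
    (hB.hasSum hw v w).unique (hform.hasSum hw v w)⟩
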